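/- Let $T=\mathbb F_2^{\oplus\mathbb N}$ be the set of finitely supported strings of $0$s and $1$s, and let $\Gamma=\mathrm{Isom}\,\mathbb F_2^{\oplus\mathbb N}$ be the group of permutations of $T$ generated by the finitely supported permutations of the index set $\mathbb N$ (acting by permuting coordinates) together with all bit-flips $x\mapsto x+e_i$, $i\in\mathbb N$. Let $K$ be a compact metric space with at least two points, and let $\mathrm{Pr}^\Gamma K^T$ be the set of Borel probability measures $\mu$ on $K^T$ that are invariant under all the maps $(\omega_t)_{t\in T}\mapsto(\omega_{\gamma(t)})_{t\in T}$, $\gamma\in\Gamma$, with the vague topology, that is, regarded as a subset of the dual of $C(K^T,\mathbb R)$ with the weak-$*$ topology through $\mu\mapsto\big(f\mapsto\int f\,d\mu\big)$. Then: 1. the extreme points of $\mathrm{Pr}^\Gamma K^T$ are exactly the ergodic measures, that is, those $\mu\in\mathrm{Pr}^\Gamma K^T$ for which every Borel set $A\subseteq K^T$ that is invariant up to $\mu$-null sets under each $\gamma\in\Gamma$ has $\mu(A)\in\{0,1\}$; 2. the ergodic measures are vaguely dense in $\mathrm{Pr}^\Gamma K^T$: their vague closure, in the space of Borel probability measures on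 $K^T$, is $\mathrm{Pr}^\Gamma K^T$; 3. $\mathrm{Pr}^\Gamma K^T$ is a Poulsen simplex, that is, a metrizable Choquet simplex with more than one point whose extreme points are dense in it. Here a Choquet simplex is a compact convex subset $S$ of a Hausdorff locally convex real vector space $E$ such that the cone $\{(rx,r): r\ge 0,\ x\in S\}\subset E\times\mathbb R$ is a lattice in its own order ($a\le b$ if and only if $b-a$ lies in the cone). -/

import Mathlib

open MeasureTheory Topology

/-- The vertex set `𝔽₂^{⊕ℕ}` of the infinite discrete cube: the finitely supported strings of
`0`s and `1`s. -/
abbrev Cube : Type := ℕ →₀ ZMod 2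

/-- The permutation of the cube induced by a permutation `σ` of the coordinates `ℕ`: the string `x`
is sent to `i ↦ x (σ⁻¹ i)`. -/
noncomputable def coordPerm (σ : Equiv.Perm ℕ) : Equiv.Perm Cube := Finsupp.equivCongrLeft σ

theorem coordPerm_apply (σ : Equiv.Perm ℕ) (x : Cube) (i : ℕ) :
    coordPerm σ x i = x (σ.symm i) := rfl

/-- The bit-flip `x ↦ x + e_i`. -/
noncomputable def bitFlip (i : ℕ) : Equiv.Perm Cube := Equiv.addRight (Finsupp.single i 1)

/-- The group of isometries of the infinite discrete cube: the group of permutations of `Cube`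
generated by the finitely supported permutations of the coordinates and all the bit-flips. -/
def cubeIsom : Subgroup (Equiv.Perm Cube) :=
  Subgroup.closure
    ({g | ∃ σ : Equiv.Perm ℕ, {i | σ i ≠ i}.Finite ∧ g = coordPerm σ} ∪ Set.range bitFlip)

/-- `DomMulAct` acts on `T → K` by the formula `τ^γ (ω) = (ω_{γ(t)})_t`. -/
theorem domMulAct_smul_eq {T : Type*} (Γ : Subgroup (Equiv.Perm T)) {K : Type*} (γ : Γ)
    (ω : T → K) : DomMulAct.mk γ • ω = fun t => ω ((γ : Equiv.Perm T) t) := rfl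

section Exchangeable

variable {T : Type*} (Γ : Subgroup (Equiv.Perm T)) (K : Type*) [MeasurableSpace K]

/-- `Pr^Γ K^T`, the `(T, Γ)`-exchangeable laws: the probability measures on `K^T` that are
invariant under `ω ↦ (ω_{γ(t)})_t` for every `γ ∈ Γ` (this is the action of `Γᵈᵐᵃ` on `T → K`). -/
def exchangeableLaws : Set (ProbabilityMeasure (T → K)) :=
  {μ | SMulInvariantMeasure Γᵈᵐᵃ (T → K) (μ : Measure (T → K))}

/-- The ergodic `(T, Γ)`-exchangeable laws: the invariant ones for which every measurable set that
is invariant under each element of `Γ` up to a null set is null or conull. -/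
def ergodicLaws : Set (ProbabilityMeasure (T → K)) :=
  {μ | ErgodicSMul Γᵈᵐᵃ (T → K) (μ : Measure (T → K))}

end Exchangeable

/-- A probability measure on a compact space as a continuous linear functional `f ↦ ∫ f dμ` on the
real continuous functions. The topology of `WeakDual` is the vague topology. -/
noncomputable def lawToDual {X : Type*} [TopologicalSpace X] [CompactSpace X] [MeasurableSpace X]
    [OpensMeasurableSpace X] (μ : ProbabilityMeasure X) : WeakDual ℝ C(X, ℝ) :=
  StrongDual.toWeakDual <| LinearMap.mkContinuous
    { toFun := fun f => ∫ x, f x ∂(μ : Measure X)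
      map_add' := fun f g => integral_add
        (BoundedContinuousFunction.integrable _ (BoundedContinuousFunction.mkOfCompact f))
        (BoundedContinuousFunction.integrable _ (BoundedContinuousFunction.mkOfCompact g))
      map_smul' := fun c f => integral_const_mul c _ } 1
    (fun f => by
      have h := norm_integral_le_of_norm_le_const (μ := (μ : Measure X))
        (Filter.Eventually.of_forall fun x => f.norm_coe_le_norm x)
      simpa using h)

theorem lawToDual_apply {X : Type*} [TopologicalSpace X] [CompactSpace X] [MeasurableSpace X]
    [OpensMeasurableSpace X] (μ : ProbabilityMeasure X) (f : C(X, ℝ)) :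
    lawToDual μ f = ∫ x, f x ∂(μ : Measure X) := rfl

section Simplex

variable {E : Type*} [AddCommGroup E] [Module ℝ E]

/-- The cone over `S`, that is, the convex cone in `E × ℝ` generated by the copy `S × {1}` of `S`
in a hyperplane that misses the origin (for nonempty convex `S`). -/
def coneOver (S : Set E) : Set (E × ℝ) :=
  {p | ∃ r : ℝ, 0 ≤ r ∧ ∃ x ∈ S, p = (r • x, r)}

/-- A cone `C` is a lattice in its own order `a ≤ b ↔ b - a ∈ C`: any two elements have a least
upper bound and a greatest lower bound. -/
def IsLatticeCone {F : Type*} [AddCommGroup F] (C : Set F) : Prop :=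
  ∀ a ∈ C, ∀ b ∈ C,
    (∃ s ∈ C, s - a ∈ C ∧ s - b ∈ C ∧ ∀ u ∈ C, u - a ∈ C → u - b ∈ C → u - s ∈ C) ∧
    (∃ i ∈ C, a - i ∈ C ∧ b - i ∈ C ∧ ∀ u ∈ C, a - u ∈ C → b - u ∈ C → i - u ∈ C)

variable [TopologicalSpace E] [IsTopologicalAddGroup E] [ContinuousSMul ℝ E]
  [LocallyConvexSpace ℝ E] [T2Space E]

/-- A Choquet simplex in a Hausdorff locally convex space: a compact convex set such that the cone
over it is a lattice in its own order. -/
structure IsChoquetSimplex (S : Set E) : Prop where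
  isCompact : IsCompact S
  convex : Convex ℝ S
  isLatticeCone : IsLatticeCone (coneOver S)

/-- A Poulsen simplex: a metrizable Choquet simplex, with more than one point, whose extreme points
are dense in it. -/
structure IsPoulsenSimplex (S : Set E) : Prop extends IsChoquetSimplex S where
  metrizable : TopologicalSpace.MetrizableSpace S
  nontrivial : S.Nontrivial
  dense_extremePoints : S ⊆ closure (S.extremePoints ℝ)

end Simplex

/-!
The three assertions rest on two separate arguments.

*The simplex.* For any group acting by homeomorphisms on a compact metrizable space, the cone over
the invariant laws is the set of finite invariant measures, and its own order is the setwise order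
of measures, because the difference of two comparable finite invariant measures is invariant. The
supremum and the infimum of two measures are determined by the order, which each group element
preserves, so they are invariant again and the cone is a lattice. An extreme law is ergodic since
it may be conditioned on an invariant set and on its complement; an ergodic law is extreme since the
density of an invariant part is an invariant function, hence constant.

*Density.* Let `μ` be an invariant law on `K ^ Cube`. Choose a random set `R` of coordinates by
putting each one into it independently with probability `p`. The finitely supported strings that
vanish on `R` form a subgroup of the cube; sample the configuration independently on its cosets, on
each with the marginal of `μ` there. The law `glueLaw μ p` of the resulting configuration is
invariant, because the law of `R` does not change when the coordinates are permuted, and the group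
preserves `μ`.

* As `p` tends to zero, the coset of the origin swallows every given finite set of vertices, so that
  `glueLaw μ p` converges to `μ` (`tendsto_integral_glueLaw`). All values of `p` are coupled by
  putting `R = {i | u i < p}` with independent uniform variables `u i`.
* It is ergodic when `0 < p` (`ergodicSMul_glueLaw`). Given a cylinder set `B` on the coordinates
  below `n`, let `γ` exchange the blocks `[0, n)` and `[n, 2n)` and then flip the bit `2n`. On the
  event `2n ∈ R`, of probability `p` when `p ≤ 1`, `γ` moves every string supported below `n` to a
  different coset, while the exchange makes the shapes of the cosets on the two windows independent;
  so there the configuration `y` and its translate by `γ` are independent on the window of `B`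
  (`sampleMeasure_glue_inter_glue`). If `A` is invariant and `B` approximates it, this
  forces `A` to be almost independent of its own complement, so `A` is null or conull.
-/

/-! ### Probability measures on a compact metrizable space as functionals -/

section Functionals

variable {X : Type*} [TopologicalSpace X] [CompactSpace X] [TopologicalSpace.MetrizableSpace X]
  [MeasurableSpace X] [BorelSpace X]

omit [TopologicalSpace.MetrizableSpace X] in
theorem continuous_lawToDual :
    Continuous (lawToDual : ProbabilityMeasure X → WeakDual ℝ C(X, ℝ)) :=
  WeakDual.continuous_of_continuous_eval fun f =>
    ProbabilityMeasure.continuous_integral_boundedContinuousFunction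
      (BoundedContinuousFunction.mkOfCompact f)

omit [CompactSpace X] in
theorem measure_ext_of_forall_integral_continuousMap {m m' : Measure X} [IsFiniteMeasure m]
    [IsFiniteMeasure m'] (h : ∀ f : C(X, ℝ), ∫ x, f x ∂m = ∫ x, f x ∂m') : m = m' :=
  ext_of_forall_integral_eq_of_IsFiniteMeasure fun f => h f.toContinuousMap

theorem lawToDual_injective :
    Function.Injective (lawToDual : ProbabilityMeasure X → WeakDual ℝ C(X, ℝ)) := fun μ ν h =>
  ProbabilityMeasure.toMeasure_injective <| measure_ext_of_forall_integral_continuousMap fun f => by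
    exact DFunLike.congr_fun h f

theorem isClosedEmbedding_lawToDual :
    IsClosedEmbedding (lawToDual : ProbabilityMeasure X → WeakDual ℝ C(X, ℝ)) :=
  continuous_lawToDual.isClosedEmbedding lawToDual_injective

omit [TopologicalSpace.MetrizableSpace X] in
theorem integrable_continuousMap {m : Measure X} [IsFiniteMeasure m] (f : C(X, ℝ)) :
    Integrable f m :=
  BoundedContinuousFunction.integrable m (BoundedContinuousFunction.mkOfCompact f)

omit [TopologicalSpace.MetrizableSpace X] in
theorem integral_ofReal_smul_add_ofReal_smul {a b : ℝ} (ha : 0 ≤ a) (hb : 0 ≤ b)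
    (μ ν : Measure X) [IsFiniteMeasure μ] [IsFiniteMeasure ν] (f : C(X, ℝ)) :
    ∫ x, f x ∂(ENNReal.ofReal a • μ + ENNReal.ofReal b • ν) =
      a * ∫ x, f x ∂μ + b * ∫ x, f x ∂ν := by
  rw [integral_add_measure ((integrable_continuousMap f).smul_measure ENNReal.ofReal_ne_top)
    ((integrable_continuousMap f).smul_measure ENNReal.ofReal_ne_top),
    integral_smul_measure, integral_smul_measure, ENNReal.toReal_ofReal ha,
    ENNReal.toReal_ofReal hb, smul_eq_mul, smul_eq_mul]

/-- A convex combination of probability measures is the same thing for measures and for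
functionals. -/
theorem smul_lawToDual_add_smul_lawToDual_eq_iff {a b : ℝ} (ha : 0 ≤ a) (hb : 0 ≤ b)
    (μ ν ρ : ProbabilityMeasure X) :
    a • lawToDual μ + b • lawToDual ν = lawToDual ρ ↔
      ENNReal.ofReal a • (μ : Measure X) + ENNReal.ofReal b • (ν : Measure X) = ρ := by
  have : IsFiniteMeasure (ENNReal.ofReal a • (μ : Measure X)) :=
    Measure.smul_finite _ ENNReal.ofReal_ne_top
  have : IsFiniteMeasure (ENNReal.ofReal b • (ν : Measure X)) :=
    Measure.smul_finite _ ENNReal.ofReal_ne_top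
  constructor
  · intro h
    refine measure_ext_of_forall_integral_continuousMap fun f => ?_
    rw [integral_ofReal_smul_add_ofReal_smul ha hb]
    exact DFunLike.congr_fun h f
  · intro h
    refine DFunLike.ext _ _ fun f => ?_
    rw [lawToDual_apply, ← h, integral_ofReal_smul_add_ofReal_smul ha hb]
    rfl

end Functionals

/-! ### Ergodic measures are the extreme invariant measures -/

section Ergodic

variable {G X : Type*} [Group G] [MulAction G X] [MeasurableSpace X] [MeasurableConstSMul G X]

/-- The density is an invariant function, hence constant by ergodicity. -/
theorem ErgodicSMul.eq_of_absolutelyContinuous {μ ν : Measure X} [IsProbabilityMeasure μ]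
    [IsProbabilityMeasure ν] [ErgodicSMul G X μ] [SMulInvariantMeasure G X ν] (h : ν ≪ μ) :
    ν = μ := by
  have hinv (g : G) : (fun x => ν.rnDeriv μ (g • x)) =ᵐ[μ] ν.rnDeriv μ :=
    (measurePreserving_smul g ν).rnDeriv_comp_aeEq (measurePreserving_smul g μ)
  obtain ⟨c, hc⟩ : ∃ c, ν.rnDeriv μ =ᵐ[μ] Function.const X c := by
    refine Filter.exists_eventuallyEq_const_of_forall_separating MeasurableSet fun U hU => ?_
    refine Filter.eventuallyConst_set.1 <| 
      MeasureTheory.aeconst_of_forall_preimage_smul_ae_eq G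
      (s := ν.rnDeriv μ ⁻¹' U) (Measure.measurable_rnDeriv ν μ hU).nullMeasurableSet fun g => ?_
    filter_upwards [hinv g] with x hx
    exact congrArg (· ∈ U) hx
  have hν : ν = c • μ := by
    rw [← Measure.withDensity_rnDeriv_eq ν μ h, withDensity_congr_ae hc]
    exact withDensity_const c
  have hc1 : c = 1 := by simpa using (congrArg (· Set.univ) hν).symm
  rw [hν, hc1, one_smul]

theorem MeasureTheory.SMulInvariantMeasure.cond {μ : Measure X} [SMulInvariantMeasure G X μ]
    {s : Set X} (h : ∀ g : G, (g • ·) ⁻¹' s =ᵐ[μ] s) :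
    SMulInvariantMeasure G X (ProbabilityTheory.cond μ s) := by
  refine ⟨fun g t ht => ?_⟩
  have hg : Measurable fun x : X => g • x := measurable_const_smul g
  simp only [ProbabilityTheory.cond, Measure.smul_apply, smul_eq_mul]
  congr 1
  rw [Measure.restrict_apply (hg ht), Measure.restrict_apply ht,
    ← MeasureTheory.measure_preimage_smul μ g (t ∩ s), Set.preimage_inter]
  exact measure_congr (Filter.EventuallyEq.rfl.inter (h g).symm)

end Ergodic

section Extreme

variable {G X : Type*} [Group G] [MulAction G X] [TopologicalSpace X] [CompactSpace X]
  [TopologicalSpace.MetrizableSpace X] [MeasurableSpace X] [BorelSpace X]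
  [ContinuousConstSMul G X]

variable (G X) in
/-- The probability measures that are invariant under the action of `G`. -/
def invariantLaws : Set (ProbabilityMeasure X) :=
  {μ | SMulInvariantMeasure G X (μ : Measure X)}

theorem lawToDual_mem_extremePoints_of_ergodicSMul {μ : ProbabilityMeasure X}
    (h : ErgodicSMul G X (μ : Measure X)) :
    lawToDual μ ∈ (lawToDual '' invariantLaws G X).extremePoints ℝ := by
  refine mem_extremePoints_iff_left.2
    ⟨⟨μ, h.toSMulInvariantMeasure, rfl⟩, ?_⟩
  rintro _ ⟨ν₁, hν₁ : SMulInvariantMeasure G X (ν₁ : Measure X), rfl⟩ _ ⟨ν₂, -, rfl⟩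
    ⟨a, b, ha, hb, -, hab⟩
  rw [smul_lawToDual_add_smul_lawToDual_eq_iff ha.le hb.le] at hab
  refine congrArg lawToDual (ProbabilityMeasure.toMeasure_injective ?_)
  refine ErgodicSMul.eq_of_absolutelyContinuous (G := G) (μ := (μ : Measure X))
    (Measure.AbsolutelyContinuous.mk ?_)
  intro s _ hs
  rw [← hab] at hs
  have hs' : (ENNReal.ofReal a • (ν₁ : Measure X)) s = 0 :=
    le_antisymm (hs ▸ Measure.le_iff'.1 (Measure.le_add_right le_rfl) s) zero_le
  simpa [ha.not_ge] using hs'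

theorem ergodicSMul_of_lawToDual_mem_extremePoints {μ : ProbabilityMeasure X}
    (h : lawToDual μ ∈ (lawToDual '' invariantLaws G X).extremePoints ℝ) :
    ErgodicSMul G X (μ : Measure X) := by
  obtain ⟨⟨μ', hμ' : SMulInvariantMeasure G X (μ' : Measure X), hμμ'⟩, hext⟩ :=
    mem_extremePoints_iff_left.1 h
  obtain rfl := lawToDual_injective hμμ'
  refine ⟨fun {s} hs hinv => ?_⟩
  by_contra hcon
  obtain ⟨h0, h0'⟩ : (μ' : Measure X) s ≠ 0 ∧ (μ' : Measure X) sᶜ ≠ 0 := by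
    simpa [Filter.eventuallyConst_set, ae_iff, and_comm] using! hcon
  have hcond {t : Set X} (ht : ∀ g : G, (g • ·) ⁻¹' t =ᵐ[(μ' : Measure X)] t)
      (h0 : (μ' : Measure X) t ≠ 0) :
      ∃ ν ∈ invariantLaws G X, (ν : Measure X) = ProbabilityTheory.cond μ' t :=
    ⟨⟨_, ProbabilityTheory.cond_isProbabilityMeasure h0⟩, SMulInvariantMeasure.cond ht, rfl⟩
  obtain ⟨ν₁, hν₁, hν₁s⟩ := hcond hinv h0
  obtain ⟨ν₂, hν₂, hν₂s⟩ := hcond (t := sᶜ) (fun g => (hinv g).compl) h0'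
  have key := hext _ ⟨ν₁, hν₁, rfl⟩ _ ⟨ν₂, hν₂, rfl⟩ ⟨(μ' : Measure X).real s,
    (μ' : Measure X).real sᶜ, ENNReal.toReal_pos h0 (measure_ne_top _ _),
    ENNReal.toReal_pos h0' (measure_ne_top _ _), by
      rw [measureReal_add_measureReal_compl hs]; simp, by
      rw [smul_lawToDual_add_smul_lawToDual_eq_iff measureReal_nonneg measureReal_nonneg, hν₁s,
        hν₂s, ofReal_measureReal, ofReal_measureReal]
      simp [ProbabilityTheory.cond, smul_smul, ENNReal.mul_inv_cancel, h0, h0',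
        Measure.restrict_add_restrict_compl hs]⟩
  rw [← lawToDual_injective key, hν₁s] at h0'
  simp [ProbabilityTheory.cond_apply, hs] at h0'

theorem extremePoints_image_lawToDual_invariantLaws :
    (lawToDual '' invariantLaws G X).extremePoints ℝ =
      lawToDual '' {μ | ErgodicSMul G X (μ : Measure X)} := by
  ext p
  constructor
  · intro hp
    obtain ⟨μ, -, rfl⟩ := hp.1
    exact ⟨μ, ergodicSMul_of_lawToDual_mem_extremePoints hp, rfl⟩
  · rintro ⟨μ, hμ, rfl⟩
    exact lawToDual_mem_extremePoints_of_ergodicSMul hμ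

omit [CompactSpace X] in
theorem isClosed_invariantLaws : IsClosed (invariantLaws G X) := by
  have h : invariantLaws G X = ⋂ g : G, {μ | μ.map
      (measurable_const_smul g : Measurable fun x : X => g • x).aemeasurable = μ} := by
    ext μ
    rw [Set.mem_iInter]
    refine ((smulInvariantMeasure_tfae G (μ : Measure X)).out 0 5).trans (forall_congr' fun g => ?_)
    exact ProbabilityMeasure.toMeasure_injective.eq_iff (a := μ.map _)
  rw [h]
  exact isClosed_iInter fun g =>
    isClosed_eq (ProbabilityMeasure.continuous_map (continuous_const_smul g)) continuous_id

end Extreme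

/-! ### The cone over the invariant laws -/

section Lattice

variable {G X : Type*} [Group G] [MulAction G X] [MeasurableSpace X] [MeasurableConstSMul G X]

theorem MeasureTheory.SMulInvariantMeasure.of_le_map {m : Measure X} [IsFiniteMeasure m]
    (h : ∀ g : G, m ≤ m.map (g • ·)) : SMulInvariantMeasure G X m := by
  refine ((smulInvariantMeasure_tfae G m).out 0 5).2 fun g => ?_
  refine (Measure.eq_of_le_of_measure_univ_eq (h g) ?_).symm
  rw [Measure.map_apply (measurable_const_smul g) .univ, Set.preimage_univ]

theorem MeasureTheory.SMulInvariantMeasure.of_map_le {m : Measure X} [IsFiniteMeasure m]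
    (h : ∀ g : G, m.map (g • ·) ≤ m) : SMulInvariantMeasure G X m := by
  refine ((smulInvariantMeasure_tfae G m).out 0 5).2 fun g => ?_
  refine Measure.eq_of_le_of_measure_univ_eq (h g) ?_
  rw [Measure.map_apply (measurable_const_smul g) .univ, Set.preimage_univ]

variable {m m' : Measure X} [SMulInvariantMeasure G X m] [SMulInvariantMeasure G X m']

theorem MeasureTheory.SMulInvariantMeasure.sup [IsFiniteMeasure (m ⊔ m')] :
    SMulInvariantMeasure G X (m ⊔ m') := by
  refine .of_le_map fun g => sup_le ?_ ?_
  · exact (measurePreserving_smul g m).map_eq.symm.le.trans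
      (Measure.map_mono le_sup_left (measurable_const_smul g))
  · exact (measurePreserving_smul g m').map_eq.symm.le.trans
      (Measure.map_mono le_sup_right (measurable_const_smul g))

theorem MeasureTheory.SMulInvariantMeasure.inf [IsFiniteMeasure (m ⊓ m')] :
    SMulInvariantMeasure G X (m ⊓ m') := by
  refine .of_map_le fun g => le_inf ?_ ?_
  · exact (Measure.map_mono inf_le_left (measurable_const_smul g)).trans
      (measurePreserving_smul g m).map_eq.le
  · exact (Measure.map_mono inf_le_right (measurable_const_smul g)).trans
      (measurePreserving_smul g m').map_eq.le

omit [MeasurableConstSMul G X] in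
theorem MeasureTheory.SMulInvariantMeasure.of_add_right {m m' : Measure X} [IsFiniteMeasure m']
    (h : SMulInvariantMeasure G X (m + m')) (h' : SMulInvariantMeasure G X m') :
    SMulInvariantMeasure G X m := by
  refine ⟨fun g s hs => ?_⟩
  have h1 := h.measure_preimage_smul g hs
  rw [Measure.add_apply, Measure.add_apply, h'.measure_preimage_smul g hs] at h1
  exact (ENNReal.add_left_inj (measure_ne_top _ _)).1 h1

end Lattice

section Cone

variable {G X : Type*} [Group G] [MulAction G X] [TopologicalSpace X] [CompactSpace X]
  [TopologicalSpace.MetrizableSpace X] [MeasurableSpace X] [BorelSpace X]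
  [ContinuousConstSMul G X]

/-- `RepresentedBy p m` says that the pair `p` is integration against `m` together with the total
mass of `m`. These are the points of the cone over a set of laws. -/
def RepresentedBy (p : WeakDual ℝ C(X, ℝ) × ℝ) (m : Measure X) : Prop :=
  (∀ f : C(X, ℝ), p.1 f = ∫ x, f x ∂m) ∧ p.2 = m.real Set.univ

omit [TopologicalSpace.MetrizableSpace X] in
theorem RepresentedBy.add {p q : WeakDual ℝ C(X, ℝ) × ℝ} {m m' : Measure X} [IsFiniteMeasure m]
    [IsFiniteMeasure m'] (hp : RepresentedBy p m) (hq : RepresentedBy q m') :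
    RepresentedBy (p + q) (m + m') := by
  refine ⟨fun f => ?_, ?_⟩
  · rw [integral_add_measure (integrable_continuousMap f) (integrable_continuousMap f), ← hp.1,
      ← hq.1]
    rfl
  · rw [measureReal_add_apply, ← hp.2, ← hq.2]
    rfl

omit [CompactSpace X] in
theorem RepresentedBy.measure_unique {p : WeakDual ℝ C(X, ℝ) × ℝ} {m m' : Measure X}
    [IsFiniteMeasure m] [IsFiniteMeasure m'] (h : RepresentedBy p m) (h' : RepresentedBy p m') :
    m = m' :=
  measure_ext_of_forall_integral_continuousMap fun f => (h.1 f).symm.trans (h'.1 f)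

omit [CompactSpace X] [TopologicalSpace.MetrizableSpace X]
  [BorelSpace X] in
theorem RepresentedBy.point_unique {p q : WeakDual ℝ C(X, ℝ) × ℝ} {m : Measure X}
    (h : RepresentedBy p m) (h' : RepresentedBy q m) : p = q :=
  Prod.ext (DFunLike.ext _ _ fun f => (h.1 f).trans (h'.1 f).symm) (h.2.trans h'.2.symm)

omit [TopologicalSpace.MetrizableSpace X]
  [ContinuousConstSMul G X] in
/-- The point of the cone that a finite measure gives. -/
theorem exists_mem_coneOver_representedBy (hne : (invariantLaws G X).Nonempty) (m : Measure X)
    [IsFiniteMeasure m] [SMulInvariantMeasure G X m] :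
    ∃ p ∈ coneOver (lawToDual '' invariantLaws G X), RepresentedBy p m := by
  rcases eq_or_ne m 0 with rfl | hm
  · obtain ⟨μ, hμ⟩ := hne
    exact ⟨((0 : ℝ) • lawToDual μ, 0), ⟨0, le_rfl, _, ⟨μ, hμ, rfl⟩, rfl⟩, fun f => by simp; rfl,
      by simp⟩
  · have := NeZero.mk hm
    refine ⟨(m.real Set.univ • lawToDual ⟨(m Set.univ)⁻¹ • m, inferInstance⟩, m.real Set.univ),
      ⟨_, measureReal_nonneg, _, ⟨_, ?_, rfl⟩, rfl⟩, fun f => ?_, rfl⟩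
    · exact (inferInstance : SMulInvariantMeasure G X ((m Set.univ)⁻¹ • m))
    · have h0 : m.real Set.univ ≠ 0 := by simpa [measureReal_eq_zero_iff] using hm
      change m.real Set.univ * ∫ x, f x ∂((m Set.univ)⁻¹ • m) = _
      rw [integral_smul_measure, ENNReal.toReal_inv, smul_eq_mul]
      exact mul_inv_cancel_left₀ h0 _

omit [TopologicalSpace.MetrizableSpace X]
  [ContinuousConstSMul G X] in
theorem exists_representedBy_of_mem_coneOver {p : WeakDual ℝ C(X, ℝ) × ℝ}
    (hp : p ∈ coneOver (lawToDual '' invariantLaws G X)) :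
    ∃ m : Measure X, IsFiniteMeasure m ∧ SMulInvariantMeasure G X m ∧ RepresentedBy p m := by
  obtain ⟨r, hr, _, ⟨μ, hμ : SMulInvariantMeasure G X (μ : Measure X), rfl⟩, rfl⟩ := hp
  refine ⟨ENNReal.ofReal r • (μ : Measure X), Measure.smul_finite _ ENNReal.ofReal_ne_top,
    inferInstance, fun f => ?_, ?_⟩
  · rw [integral_smul_measure, ENNReal.toReal_ofReal hr]
    rfl
  · simp [hr]

omit [ContinuousConstSMul G X] in
/-- The order of the cone is the order of measures. -/
theorem sub_mem_coneOver_iff (hne : (invariantLaws G X).Nonempty)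
    {p q : WeakDual ℝ C(X, ℝ) × ℝ} {m m' : Measure X} [IsFiniteMeasure m] [IsFiniteMeasure m']
    (hm : SMulInvariantMeasure G X m) (hm' : SMulInvariantMeasure G X m')
    (hp : RepresentedBy p m) (hq : RepresentedBy q m') :
    p - q ∈ coneOver (lawToDual '' invariantLaws G X) ↔ m' ≤ m := by
  constructor
  · intro h
    obtain ⟨k, hk, -, hpk⟩ := exists_representedBy_of_mem_coneOver h
    have := hpk.add hq
    rw [sub_add_cancel] at this
    rw [hp.measure_unique this]
    exact Measure.le_add_left le_rfl
  · intro h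
    have hsub : m - m' + m' = m := Measure.sub_add_cancel_of_le h
    have hinv : SMulInvariantMeasure G X (m - m') := .of_add_right (hsub.symm ▸ hm) hm'
    obtain ⟨r, hr, hrm⟩ := exists_mem_coneOver_representedBy hne (m - m')
    have := hrm.add hq
    rw [hsub] at this
    rwa [hp.point_unique this, add_sub_cancel_right]

theorem isLatticeCone_coneOver_invariantLaws (hne : (invariantLaws G X).Nonempty) :
    IsLatticeCone (coneOver (lawToDual '' invariantLaws G X)) := by
  intro a ha b hb
  obtain ⟨m, hm, hmi, ham⟩ := exists_representedBy_of_mem_coneOver ha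
  obtain ⟨n, hn, hni, hbn⟩ := exists_representedBy_of_mem_coneOver hb
  have : IsFiniteMeasure (m ⊔ n) := isFiniteMeasure_of_le (m + n)
    (sup_le (Measure.le_add_right le_rfl) (Measure.le_add_left le_rfl))
  have : IsFiniteMeasure (m ⊓ n) := isFiniteMeasure_of_le m inf_le_left
  have hsup : SMulInvariantMeasure G X (m ⊔ n) := .sup
  have hinf : SMulInvariantMeasure G X (m ⊓ n) := .inf
  obtain ⟨s, hs, hsm⟩ := exists_mem_coneOver_representedBy hne (m ⊔ n)
  obtain ⟨i, hi, him⟩ := exists_mem_coneOver_representedBy hne (m ⊓ n)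
  refine ⟨⟨s, hs, (sub_mem_coneOver_iff hne hsup hmi hsm ham).2 le_sup_left,
    (sub_mem_coneOver_iff hne hsup hni hsm hbn).2 le_sup_right, fun u hu hua hub => ?_⟩,
    ⟨i, hi, (sub_mem_coneOver_iff hne hmi hinf ham him).2 inf_le_left,
    (sub_mem_coneOver_iff hne hni hinf hbn him).2 inf_le_right, fun u hu hua hub => ?_⟩⟩
  all_goals obtain ⟨k, hk, hki, huk⟩ := exists_representedBy_of_mem_coneOver hu
  · rw [sub_mem_coneOver_iff hne hki hmi huk ham] at hua
    rw [sub_mem_coneOver_iff hne hki hni huk hbn] at hub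
    exact (sub_mem_coneOver_iff hne hki hsup huk hsm).2 (sup_le hua hub)
  · rw [sub_mem_coneOver_iff hne hmi hki ham huk] at hua
    rw [sub_mem_coneOver_iff hne hni hki hbn huk] at hub
    exact (sub_mem_coneOver_iff hne hinf hki him huk).2 (le_inf hua hub)

omit [ContinuousConstSMul G X] in
theorem convex_image_lawToDual_invariantLaws :
    Convex ℝ (lawToDual '' invariantLaws G X) := by
  rintro _ ⟨μ, hμ : SMulInvariantMeasure G X (μ : Measure X), rfl⟩
    _ ⟨ν, hν : SMulInvariantMeasure G X (ν : Measure X), rfl⟩ a b ha hb hab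
  have hρ : IsProbabilityMeasure
      (ENNReal.ofReal a • (μ : Measure X) + ENNReal.ofReal b • (ν : Measure X)) :=
    ⟨by simp [← ENNReal.ofReal_add ha hb, hab]⟩
  refine ⟨⟨_, hρ⟩, ?_, ((smul_lawToDual_add_smul_lawToDual_eq_iff ha hb _ _ _).2 rfl).symm⟩
  exact (inferInstance : SMulInvariantMeasure G X
    (ENNReal.ofReal a • (μ : Measure X) + ENNReal.ofReal b • (ν : Measure X)))

/-- The invariant laws form a Choquet simplex. -/
theorem isChoquetSimplex_image_lawToDual_invariantLaws (hne : (invariantLaws G X).Nonempty) :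
    IsChoquetSimplex (lawToDual '' invariantLaws G X) where
  isCompact := isClosed_invariantLaws.isCompact.image continuous_lawToDual
  convex := convex_image_lawToDual_invariantLaws
  isLatticeCone := isLatticeCone_coneOver_invariantLaws hne

theorem metrizableSpace_image_lawToDual (s : Set (ProbabilityMeasure X)) :
    TopologicalSpace.MetrizableSpace (lawToDual '' s) :=
  (isClosedEmbedding_lawToDual.isEmbedding.homeomorphImage s).symm.isEmbedding.metrizableSpace

end Cone

/-! ### Gluing independent copies of a law along random cosets -/

section Glue

/-- A choice, measurable in `z`, among countably many measurable functions is measurable. -/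
theorem measurable_apply_of_countable {Ω ι K : Type*} [MeasurableSpace Ω] [MeasurableSpace K]
    [Countable ι] {l : Ω → ι} (hl : ∀ v, MeasurableSet {z | l z = v}) {f : ι → Ω → K}
    (hf : ∀ v, Measurable (f v)) : Measurable fun z => f (l z) z := by
  intro S hS
  have : (fun z => f (l z) z) ⁻¹' S = ⋃ v, {z | l z = v} ∩ f v ⁻¹' S := by
    ext z
    simp
  rw [this]
  exact .iUnion fun v => (hl v).inter (hf v hS)

/-- Two functions that depend on disjoint finite sets of coordinates are independent under a
product measure. -/
theorem indepFun_infinitePi_of_dependsOn {ι Y β β' : Type*} [MeasurableSpace Y]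
    [MeasurableSpace β] [MeasurableSpace β'] (P : Measure Y) [IsProbabilityMeasure P]
    {f : (ι → Y) → β} {g : (ι → Y) → β'} (hf : Measurable f) (hg : Measurable g)
    {s t : Finset ι} (hst : Disjoint s t) (hfs : DependsOn f s) (hgt : DependsOn g t) :
    ProbabilityTheory.IndepFun f g (Measure.infinitePi fun _ : ι => P) := by
  classical
  obtain ⟨y₀⟩ : Nonempty Y := nonempty_of_isProbabilityMeasure P
  let ext (r : Finset ι) (x : r → Y) (i : ι) : Y := if h : i ∈ r then x ⟨i, h⟩ else y₀
  have hext (r : Finset ι) : Measurable (ext r) := by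
    refine measurable_pi_iff.2 fun i => ?_
    by_cases h : i ∈ r
    · simpa [ext, h] using measurable_pi_apply _
    · simp [ext, h]
  have key := (ProbabilityTheory.iIndepFun_infinitePi (P := fun _ : ι => P)
    (X := fun _ y => y) fun _ => measurable_id).indepFun_finset s t hst
    fun i => measurable_pi_apply i
  have hfe : f = (f ∘ ext s) ∘ fun a (i : s) => a i := by
    funext a
    exact hfs fun i hi => by simp [ext, Finset.mem_coe.1 hi]
  have hge : g = (g ∘ ext t) ∘ fun a (i : t) => a i := by
    funext a
    exact hgt fun i hi => by simp [ext, Finset.mem_coe.1 hi]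
  rw [hfe, hge]
  exact key.comp (hf.comp (hext s)) (hg.comp (hext t))

/-- The part of the string `t` that lies on the random set of coordinates `{i | u i < p}`. Two
strings have the same label if and only if they lie in the same coset of the strings supported on
the complement of that set. -/
noncomputable def label (p : ℝ) (u : ℕ → ℝ) (t : Cube) : Cube :=
  open Classical in t.filter fun i => u i < p

theorem label_apply_of_lt {p : ℝ} {u : ℕ → ℝ} {i : ℕ} (h : u i < p) (t : Cube) :
    label p u t i = t i := Finsupp.filter_apply_pos _ _ h

theorem label_apply_of_le {p : ℝ} {u : ℕ → ℝ} {i : ℕ} (h : p ≤ u i) (t : Cube) :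
    label p u t i = 0 := Finsupp.filter_apply_neg _ _ h.not_gt

theorem label_apply_eq_zero {p : ℝ} {u : ℕ → ℝ} {i : ℕ} {t : Cube} (h : t i = 0) :
    label p u t i = 0 := by
  rcases lt_or_ge (u i) p with hi | hi
  · rw [label_apply_of_lt hi, h]
  · exact label_apply_of_le hi t

theorem label_congr {p : ℝ} {u u' : ℕ → ℝ} {t : Cube} (h : ∀ i, t i ≠ 0 → u i = u' i) :
    label p u t = label p u' t := by
  ext i
  by_cases hi : t i = 0
  · rw [label_apply_eq_zero hi, label_apply_eq_zero hi]
  · rcases lt_or_ge (u i) p with hu | hu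
    · rw [label_apply_of_lt hu, label_apply_of_lt (h i hi ▸ hu)]
    · rw [label_apply_of_le hu, label_apply_of_le (h i hi ▸ hu)]

theorem label_add (p : ℝ) (u : ℕ → ℝ) (s t : Cube) :
    label p u (s + t) = label p u s + label p u t := by
  classical
  exact Finsupp.filter_add

theorem label_coordPerm (p : ℝ) (u : ℕ → ℝ) (σ : Equiv.Perm ℕ) (t : Cube) :
    label p u (coordPerm σ t) = coordPerm σ (label p (fun i => u (σ i)) t) := by
  ext i
  rw [coordPerm_apply]
  rcases lt_or_ge (u i) p with hu | hu
  · rw [label_apply_of_lt hu, label_apply_of_lt (by simpa using hu), coordPerm_apply]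
  · rw [label_apply_of_le hu, label_apply_of_le (by simpa using hu)]

theorem label_single_of_lt {p : ℝ} {u : ℕ → ℝ} {i : ℕ} (h : u i < p) (a : ZMod 2) :
    label p u (Finsupp.single i a) = Finsupp.single i a := by
  classical
  exact Finsupp.filter_single_of_pos _ h

theorem measurableSet_label_eq (p : ℝ) (t v : Cube) : MeasurableSet {u | label p u t = v} := by
  have : {u | label p u t = v} =
      ⋂ i, ({u : ℕ → ℝ | u i < p} ∩ {_u | t i = v i}) ∪
        ({u : ℕ → ℝ | p ≤ u i} ∩ {_u | 0 = v i}) := by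
    ext u
    simp only [Set.mem_ofPred_eq, Set.mem_iInter, Set.mem_union, Set.mem_inter_iff,
      DFunLike.ext_iff]
    refine forall_congr' fun i => ?_
    rcases lt_or_ge (u i) p with hu | hu
    · simp [label_apply_of_lt hu, hu, hu.not_ge]
    · simp [label_apply_of_le hu, hu, hu.not_gt]
  rw [this]
  exact .iInter fun i =>
    ((measurableSet_lt (measurable_pi_apply i) measurable_const).inter (.const _)).union
      ((measurableSet_le measurable_const (measurable_pi_apply i)).inter (.const _))

variable {K : Type*}

/-- The configuration that agrees with `ω v` on the coset of label `v`, for every `v`. -/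
noncomputable def glue (p : ℝ) (z : (ℕ → ℝ) × (Cube → Cube → K)) : Cube → K :=
  fun t => z.2 (label p z.1 t) t

/-- Relabelling the cosets by `e` and the coordinates by `σ`, and moving every copy by `γ`. The
relabelling `e` may depend on the random set. -/
def relabel (γ : Equiv.Perm Cube) (σ : Equiv.Perm ℕ) (e : (ℕ → ℝ) → Equiv.Perm Cube)
    (z : (ℕ → ℝ) × (Cube → Cube → K)) : (ℕ → ℝ) × (Cube → Cube → K) :=
  (fun i => z.1 (σ i), fun v t => z.2 (e z.1 v) (γ t))

variable [MeasurableSpace K]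

theorem measurable_glue (p : ℝ) :
    Measurable (glue p : (ℕ → ℝ) × (Cube → Cube → K) → Cube → K) :=
  measurable_pi_iff.2 fun t => measurable_apply_of_countable
    (f := fun v (z : (ℕ → ℝ) × (Cube → Cube → K)) => z.2 v t)
    (fun v => measurable_fst (measurableSet_label_eq p t v)) fun v => by fun_prop

/-- The uniform distribution on `(0, 1]`, as a measure on `ℝ`. -/
noncomputable def uniformUnit : Measure ℝ := volume.restrict (Set.Ioc 0 1)

instance : IsProbabilityMeasure uniformUnit := ⟨by simp [uniformUnit]⟩

/-- Independent uniform variables, one for each coordinate of the cube, and independent samples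
from `μ`, one for each vertex of the cube. -/
noncomputable def sampleMeasure (μ : Measure (Cube → K)) :
    Measure ((ℕ → ℝ) × (Cube → Cube → K)) :=
  (Measure.infinitePi fun _ => uniformUnit).prod (Measure.infinitePi fun _ => μ)

variable (μ : Measure (Cube → K)) [IsProbabilityMeasure μ]

instance : IsProbabilityMeasure (sampleMeasure μ) := by
  unfold sampleMeasure
  infer_instance

/-- The law of the configuration obtained by gluing independent samples from `μ` along the cosets
of a random subgroup of the cube, that of the strings supported off a random set of coordinates
of density `p`. -/
noncomputable def glueLaw (p : ℝ) : Measure (Cube → K) := (sampleMeasure μ).map (glue p)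

instance (p : ℝ) : IsProbabilityMeasure (glueLaw μ p) :=
  Measure.isProbabilityMeasure_map (measurable_glue p).aemeasurable

omit [IsProbabilityMeasure μ] in
theorem measurePreserving_glue (p : ℝ) :
    MeasurePreserving (glue p) (sampleMeasure μ) (glueLaw μ p) := ⟨measurable_glue p, rfl⟩

variable {μ}

/-- The samples are exchangeable, so a relabelling preserves their law even when it depends on the
uniform variables. -/
theorem measurePreserving_relabel {γ : Equiv.Perm Cube}
    (hγ : MeasurePreserving (fun (y : Cube → K) t => y (γ t)) μ μ) (σ : Equiv.Perm ℕ)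
    {e : (ℕ → ℝ) → Equiv.Perm Cube} (he : ∀ v w, MeasurableSet {u | e u v = w}) :
    MeasurePreserving (relabel γ σ e) (sampleMeasure μ) (sampleMeasure μ) := by
  refine MeasurePreserving.skew_product (f := fun (u : ℕ → ℝ) i => u (σ i))
    (g := fun u (ω : Cube → Cube → K) v t => ω (e u v) (γ t)) ⟨by fun_prop, ?_⟩ ?_
    (.of_forall fun u => ?_)
  · exact Measure.map_infinitePi_infinitePi_of_inj σ.injective
  · refine measurable_pi_iff.2 fun v => measurable_pi_iff.2 fun t => ?_
    exact measurable_apply_of_countable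
      (f := fun w (z : (ℕ → ℝ) × (Cube → Cube → K)) => z.2 w (γ t))
      (fun w => measurable_fst (he v w)) fun w => by fun_prop
  · have h1 := Measure.map_infinitePi_infinitePi_of_inj (P := fun _ : Cube => μ) (e u).injective
    have h2 := Measure.infinitePi_map_pi (fun _ : Cube => μ)
      (f := fun _ (y : Cube → K) t => y (γ t)) fun _ => hγ.measurable
    rw [hγ.map_eq] at h2
    conv_rhs => rw [← h2, ← h1]
    rw [Measure.map_map (by fun_prop) (by fun_prop)]
    rfl

/-- Translating the glued configuration by `t ↦ σ t + a` amounts to permuting the random set by `σ`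
and adding the label of `a` to the labels. -/
theorem measurePreserving_glueLaw {p : ℝ} {γ : Equiv.Perm Cube}
    (hγ : MeasurePreserving (fun (y : Cube → K) t => y (γ t)) μ μ) (σ : Equiv.Perm ℕ) (a : Cube)
    (hγa : ∀ t, γ t = coordPerm σ t + a) :
    MeasurePreserving (fun (y : Cube → K) t => y (γ t)) (glueLaw μ p) (glueLaw μ p) := by
  have hm : Measurable fun (y : Cube → K) t => y (γ t) := by fun_prop
  refine ⟨hm, ?_⟩
  have hrel := measurePreserving_relabel hγ σ
    (e := fun u => (coordPerm σ).trans (Equiv.addRight (label p u a))) fun v w => by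
      simpa [← eq_sub_iff_add_eq'] using measurableSet_label_eq p a (w - coordPerm σ v)
  rw [glueLaw, Measure.map_map hm (measurable_glue p)]
  conv_rhs => rw [← hrel.map_eq, Measure.map_map (measurable_glue p) hrel.measurable]
  congr 1
  funext z t
  simp [glue, relabel, hγa, label_add, label_coordPerm]

theorem ae_sampleMeasure_forall_pos : ∀ᵐ z ∂sampleMeasure μ, ∀ i, 0 < z.1 i := by
  refine ae_all_iff.2 fun i => ?_
  have h : ∀ᵐ x ∂uniformUnit, 0 < x :=
    (ae_restrict_mem measurableSet_Ioc).mono fun x hx => hx.1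
  exact ((measurePreserving_eval_infinitePi (fun _ : ℕ => uniformUnit) i).comp
    measurePreserving_fst).quasiMeasurePreserving.ae h

theorem measurePreserving_sample (v : Cube) :
    MeasurePreserving (fun z => z.2 v) (sampleMeasure μ) μ :=
  (measurePreserving_eval_infinitePi (fun _ : Cube => μ) v).comp measurePreserving_snd

omit [MeasurableSpace K] in
/-- As `p → 0`, every vertex ends up in the coset of the origin. -/
theorem tendsto_glue {z : (ℕ → ℝ) × (Cube → Cube → K)} [TopologicalSpace K]
    (hz : ∀ i, 0 < z.1 i) :
    Filter.Tendsto (fun p => glue p z) (𝓝 0) (𝓝 (z.2 0)) := by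
  refine tendsto_pi_nhds.2 fun t => tendsto_const_nhds.congr' ?_
  have : ∀ᶠ p in 𝓝 (0 : ℝ), ∀ i ∈ t.support, p < z.1 i :=
    (Filter.eventually_all_finset _).2 fun i _ => eventually_lt_nhds (hz i)
  filter_upwards [this] with p hp
  have : label p z.1 t = 0 := by
    ext i
    by_cases hi : t i = 0
    · exact label_apply_eq_zero hi
    · exact label_apply_of_le (hp i (Finsupp.mem_support_iff.2 hi)).le t
  rw [glue, this]

theorem tendsto_integral_glueLaw [TopologicalSpace K] [OpensMeasurableSpace (Cube → K)]
    (f : BoundedContinuousFunction (Cube → K) ℝ) :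
    Filter.Tendsto (fun p => ∫ y, f y ∂glueLaw μ p) (𝓝 0) (𝓝 (∫ y, f y ∂μ)) := by
  have hf : Measurable f := f.continuous.measurable
  have h1 (p : ℝ) : ∫ y, f y ∂glueLaw μ p = ∫ z, f (glue p z) ∂sampleMeasure μ :=
    integral_map (measurable_glue p).aemeasurable hf.aestronglyMeasurable
  have h2 : ∫ y, f y ∂μ = ∫ z, f (z.2 0) ∂sampleMeasure μ := by
    conv_lhs => rw [← (measurePreserving_sample (μ := μ) 0).map_eq]
    exact integral_map (measurePreserving_sample (μ := μ) 0).measurable.aemeasurable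
      hf.aestronglyMeasurable
  simp only [h1, h2]
  refine tendsto_integral_filter_of_dominated_convergence (fun _ => ‖f‖)
    (.of_forall fun p => (hf.comp (measurable_glue p)).aestronglyMeasurable)
    (.of_forall fun p => .of_forall fun z => f.norm_coe_le_norm _) (integrable_const _) ?_
  filter_upwards [ae_sampleMeasure_forall_pos (μ := μ)] with z hz
  exact (f.continuous.tendsto _).comp (tendsto_glue hz)

end Glue

/-! ### Ergodicity of the glued laws -/

section Independence

variable {K : Type*} [MeasurableSpace K] {μ : Measure (Cube → K)} [IsProbabilityMeasure μ]

/-- If the coordinate `i` belongs to the random set, then the vertices `t ∈ s` and the vertices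
`σ t + e_i` lie in different cosets, so that independent samples from `μ` are seen there. The
cosets themselves are determined by disjoint sets of uniform variables when `σ` moves the
coordinates used by `s` off themselves. -/
theorem sampleMeasure_glue_inter_glue {γ : Equiv.Perm Cube}
    (hγ : MeasurePreserving (fun (y : Cube → K) t => y (γ t)) μ μ) {σ : Equiv.Perm ℕ} {i n : ℕ}
    (hγσ : ∀ t, γ t = coordPerm σ t + Finsupp.single i 1) (hσ : ∀ j < n, n ≤ σ j)
    (hi : n ≤ i) (hσi : σ i = i) {s : Finset Cube} (hs : ∀ t ∈ s, ∀ j, n ≤ j → t j = 0)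
    {S C : Set (s → K)} (hS : MeasurableSet S) (hC : MeasurableSet C) (p : ℝ) :
    sampleMeasure μ ({z | z.1 i < p} ∩ (glue p ⁻¹' cylinder s S ∩
      {z | (fun t => glue p z (γ t)) ∈ cylinder s C})) =
      uniformUnit (Set.Iio p) *
        (glueLaw μ p (cylinder s S) * glueLaw μ p (cylinder s C)) := by
  classical
  set e : Equiv.Perm Cube := (coordPerm σ).trans (Equiv.addRight (Finsupp.single i 1)) with he
  have hrel := measurePreserving_relabel hγ σ (e := fun _ => e) fun v w => .const _
  set θ : (ℕ → ℝ) × (Cube → Cube → K) → (ℕ → ℝ) × (Cube → Cube → K) :=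
    relabel γ σ fun _ => e with hθ
  -- On the event that `i` belongs to the random set, moving the configuration by `γ`
  -- amounts to gluing the relabelled samples `θ z`, which no longer involves `u i`.
  have hset : {z : (ℕ → ℝ) × (Cube → Cube → K) | z.1 i < p} ∩ (glue p ⁻¹' cylinder s S ∩
      {z | (fun t => glue p z (γ t)) ∈ cylinder s C}) =
      {z | z.1 i < p} ∩ (glue p ⁻¹' cylinder s S ∩ (glue p ∘ θ) ⁻¹' cylinder s C) := by
    ext z
    refine and_congr_right fun hz : z.1 i < p => and_congr_right fun _ => ?_
    have : (fun t => glue p z (γ t)) = glue p (θ z) := by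
      funext t
      simp [glue, hθ, he, relabel, hγσ, label_add, label_coordPerm, label_single_of_lt hz]
    rw [Set.mem_ofPred_eq, this]
    rfl
  have hmS : MeasurableSet (glue p ⁻¹' cylinder s S : Set ((ℕ → ℝ) × (Cube → Cube → K))) :=
    measurable_glue p hS.cylinder
  have hmC : MeasurableSet ((glue p ∘ θ) ⁻¹' cylinder s C) :=
    ((measurable_glue p).comp hrel.measurable) hC.cylinder
  have hmD : MeasurableSet {z : (ℕ → ℝ) × (Cube → Cube → K) | z.1 i < p} :=
    measurableSet_lt (by fun_prop) measurable_const
  set P := Measure.infinitePi fun _ : Cube => μ with hP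
  set U := Measure.infinitePi fun _ : ℕ => uniformUnit with hU
  set d : (ℕ → ℝ) → ENNReal := fun u => (Set.Iio p).indicator 1 (u i) with hd
  set h : (ℕ → ℝ) → ENNReal := fun u => P (Prod.mk u ⁻¹' (glue p ⁻¹' cylinder s S)) with hh
  set h' : (ℕ → ℝ) → ENNReal := fun u => P (Prod.mk u ⁻¹' ((glue p ∘ θ) ⁻¹' cylinder s C))
    with hh'
  have hdm : Measurable d := (measurable_one.indicator measurableSet_Iio).comp
    (measurable_pi_apply i)
  have hhm : Measurable h := measurable_measure_prodMk_left hmS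
  have hhm' : Measurable h' := measurable_measure_prodMk_left hmC
  have hdI : ∫⁻ u, d u ∂U = uniformUnit (Set.Iio p) := by
    rw [(measurePreserving_eval_infinitePi (fun _ : ℕ => uniformUnit) i).lintegral_comp
      (f := (Set.Iio p).indicator 1) (measurable_one.indicator measurableSet_Iio),
      lintegral_indicator_one measurableSet_Iio]
  have hhI : ∫⁻ u, h u ∂U = glueLaw μ p (cylinder s S) := by
    rw [← (measurePreserving_glue μ p).measure_preimage hS.cylinder.nullMeasurableSet]
    exact (Measure.prod_apply hmS).symm
  have hhI' : ∫⁻ u, h' u ∂U = glueLaw μ p (cylinder s C) := by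
    rw [← ((measurePreserving_glue μ p).comp hrel).measure_preimage hC.cylinder.nullMeasurableSet]
    exact (Measure.prod_apply hmC).symm
  -- Given the random set, the two events read disjoint families of samples.
  have hfiber (u : ℕ → ℝ) : P (Prod.mk u ⁻¹' ({z | z.1 i < p} ∩ (glue p ⁻¹' cylinder s S ∩
      (glue p ∘ θ) ⁻¹' cylinder s C))) = d u * (h u * h' u) := by
    by_cases hu : u i < p
    · have hdu : d u = 1 := Set.indicator_of_mem (Set.mem_Iio.2 hu) _
      have hind : ProbabilityTheory.IndepFun
          (fun (ω : Cube → Cube → K) (t : s) => ω (label p u t) t)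
          (fun (ω : Cube → Cube → K) (t : s) => ω (e (label p (fun j => u (σ j)) t)) (γ t)) P := by
        refine indepFun_infinitePi_of_dependsOn μ (by fun_prop) (by fun_prop)
          (s := s.image (label p u)) (t := s.image fun t => e (label p (fun j => u (σ j)) t))
          ?_ ?_ ?_
        · refine Finset.disjoint_left.2 fun v hv hv' => ?_
          obtain ⟨t, ht, rfl⟩ := Finset.mem_image.1 hv
          obtain ⟨t', ht', htt'⟩ := Finset.mem_image.1 hv'
          have hcoord := DFunLike.congr_fun htt' i
          have hσi' : σ.symm i = i := σ.symm_apply_eq.2 hσi.symm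
          simp [he, coordPerm_apply, hσi', label_apply_eq_zero (hs t ht i hi),
            label_apply_eq_zero (hs t' ht' i hi)] at hcoord
        · intro ω ω' hω
          funext t
          exact congrFun (hω _ (Finset.mem_coe.2 (Finset.mem_image_of_mem _ t.2))) _
        · intro ω ω' hω
          funext t
          exact congrFun (hω _ (Finset.mem_coe.2 (Finset.mem_image.2 ⟨t, t.2, rfl⟩))) _
      rw [hdu, one_mul]
      refine Eq.trans (congrArg P ?_) (hind.measure_inter_preimage_eq_mul S C hS hC)
      ext ω
      exact and_iff_right hu
    · have hdu : d u = 0 := Set.indicator_of_notMem (by simpa using hu) _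
      rw [hdu, zero_mul]
      refine (congrArg P ?_).trans measure_empty
      ext ω
      exact iff_of_false (fun h => hu h.1) id
  have hdd : DependsOn d ({i} : Finset ℕ) := fun u u' huu' => by
    simp only [hd, huu' i (by simp)]
  -- The labels of the vertices in `s` only read the uniform variables below `n`, and those of their
  -- images only read the variables in `σ [0, n)`.
  have hhd : DependsOn h (Finset.range n) := fun u u' huu' => by
    refine congrArg P ?_
    ext ω
    have : ∀ t ∈ s, label p u t = label p u' t := fun t ht => label_congr fun j hj =>
      huu' j (by simpa using not_le.1 fun hn => hj (hs t ht j hn))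
    have : s.restrict (glue p (u, ω)) = s.restrict (glue p (u', ω)) := by
      funext t
      simp [glue, this t t.2]
    simp [cylinder, this]
  have hhd' : DependsOn h' ((Finset.range n).image σ) := fun u u' huu' => by
    refine congrArg P ?_
    ext ω
    have : ∀ t ∈ s, label p (fun j => u (σ j)) t = label p (fun j => u' (σ j)) t := fun t ht =>
      label_congr fun j hj => huu' _ <| Finset.mem_coe.2 <| Finset.mem_image_of_mem _ <| by
        simpa using not_le.1 fun hn => hj (hs t ht j hn)
    have : s.restrict (glue p (θ (u, ω))) = s.restrict (glue p (θ (u', ω))) := by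
      funext t
      simp [glue, hθ, relabel, this t t.2]
    simp [cylinder, this]
  have hdisj : Disjoint (Finset.range n) ((Finset.range n).image σ) := by
    refine Finset.disjoint_left.2 fun j hj hj' => ?_
    obtain ⟨k, hk, rfl⟩ := Finset.mem_image.1 hj'
    exact (Finset.mem_range.1 hj).not_ge (hσ k (Finset.mem_range.1 hk))
  have hidisj : Disjoint {i} (Finset.range n ∪ (Finset.range n).image σ) := by
    refine Finset.disjoint_singleton_left.2 fun hmem => ?_
    rcases Finset.mem_union.1 hmem with hmem | hmem
    · exact (Finset.mem_range.1 hmem).not_ge hi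
    · obtain ⟨k, hk, hki⟩ := Finset.mem_image.1 hmem
      have : k = i := σ.injective (hki.trans hσi.symm)
      exact (Finset.mem_range.1 hk).not_ge (this ▸ hi)
  have hind : ProbabilityTheory.IndepFun h h' U :=
    indepFun_infinitePi_of_dependsOn uniformUnit hhm hhm' hdisj hhd hhd'
  have hind' : ProbabilityTheory.IndepFun d (h * h') U := by
    refine indepFun_infinitePi_of_dependsOn uniformUnit hdm (hhm.mul hhm') hidisj hdd ?_
    intro u u' huu'
    rw [Pi.mul_apply, Pi.mul_apply,
      hhd fun j hj => huu' j (Finset.mem_coe.2 (Finset.mem_union_left _ (Finset.mem_coe.1 hj))),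
      hhd' fun j hj => huu' j (Finset.mem_coe.2 (Finset.mem_union_right _ (Finset.mem_coe.1 hj)))]
  rw [hset, sampleMeasure, Measure.prod_apply (hmD.inter (hmS.inter hmC)), lintegral_congr hfiber,
    ← hdI, ← hhI, ← hhI']
  exact (ProbabilityTheory.lintegral_mul_eq_lintegral_mul_lintegral_of_indepFun hdm
    (hhm.mul hhm') hind').trans (congrArg _
      (ProbabilityTheory.lintegral_mul_eq_lintegral_mul_lintegral_of_indepFun hhm hhm' hind))

end Independence

section Exchangeable

/-- The permutation of `ℕ` that exchanges the intervals `[0, n)` and `[n, 2n)`. -/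
def blockSwap (n : ℕ) : Equiv.Perm ℕ :=
  Function.Involutive.toPerm (fun j => if j < n then j + n else if j < 2 * n then j - n else j)
    fun j => by grind

theorem blockSwap_apply (n j : ℕ) :
    blockSwap n j = if j < n then j + n else if j < 2 * n then j - n else j := rfl

theorem le_blockSwap {n j : ℕ} (h : j < n) : n ≤ blockSwap n j := by
  simp [blockSwap_apply, h]

theorem blockSwap_of_le {n j : ℕ} (h : 2 * n ≤ j) : blockSwap n j = j := by
  rw [blockSwap_apply, if_neg (by omega), if_neg (by omega)]

theorem finite_blockSwap_ne (n : ℕ) : {j | blockSwap n j ≠ j}.Finite :=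
  (Set.finite_Iio (2 * n)).subset fun _ hj => not_le.1 fun h => hj (blockSwap_of_le h)

theorem bitFlip_apply (i : ℕ) (t : Cube) : bitFlip i t = t + Finsupp.single i 1 := rfl

theorem coordPerm_one (t : Cube) : coordPerm 1 t = t := by
  ext i
  rfl

theorem coordPerm_mem_cubeIsom {σ : Equiv.Perm ℕ} (h : {i | σ i ≠ i}.Finite) :
    coordPerm σ ∈ cubeIsom := Subgroup.subset_closure (.inl ⟨σ, h, rfl⟩)

theorem bitFlip_mem_cubeIsom (i : ℕ) : bitFlip i ∈ cubeIsom :=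
  Subgroup.subset_closure (.inr ⟨i, rfl⟩)

instance {T K : Type*} [MeasurableSpace K] (Γ : Subgroup (Equiv.Perm T)) :
    MeasurableConstSMul Γᵈᵐᵃ (T → K) :=
  ⟨fun γ => measurable_pi_iff.2 fun t => measurable_pi_apply (DomMulAct.mk.symm γ • t)⟩

instance {T K : Type*} [TopologicalSpace K] (Γ : Subgroup (Equiv.Perm T)) :
    ContinuousConstSMul Γᵈᵐᵃ (T → K) :=
  ⟨fun γ => continuous_pi fun t => continuous_apply (DomMulAct.mk.symm γ • t)⟩

theorem smulInvariantMeasure_iff_forall_measurePreserving {T K : Type*} [MeasurableSpace K]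
    {Γ : Subgroup (Equiv.Perm T)} {μ : Measure (T → K)} :
    SMulInvariantMeasure Γᵈᵐᵃ (T → K) μ ↔
      ∀ γ ∈ Γ, MeasurePreserving (fun (y : T → K) t => y (γ t)) μ μ := by
  refine ((smulInvariantMeasure_tfae Γᵈᵐᵃ μ).out 0 6).trans ⟨fun h γ hγ => ?_, fun h γ => ?_⟩
  · exact h (DomMulAct.mk ⟨γ, hγ⟩)
  · exact h _ (DomMulAct.mk.symm γ).2

variable {K : Type*} [MeasurableSpace K] {μ : Measure (Cube → K)}

/-- It is enough to test invariance on the generators of the group. -/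
theorem smulInvariantMeasure_cubeIsom
    (h₁ : ∀ σ : Equiv.Perm ℕ, {i | σ i ≠ i}.Finite →
      MeasurePreserving (fun (y : Cube → K) t => y (coordPerm σ t)) μ μ)
    (h₂ : ∀ i, MeasurePreserving (fun (y : Cube → K) t => y (bitFlip i t)) μ μ) :
    SMulInvariantMeasure cubeIsomᵈᵐᵃ (Cube → K) μ := by
  refine smulInvariantMeasure_iff_forall_measurePreserving.2 fun γ hγ => ?_
  induction hγ using Subgroup.closure_induction with
  | mem γ hγ =>
    rcases hγ with ⟨σ, hσ, rfl⟩ | ⟨i, rfl⟩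
    · exact h₁ σ hσ
    · exact h₂ i
  | one => exact .id μ
  | mul γ γ' _ _ hγ hγ' => exact hγ'.comp hγ
  | inv γ _ hγ =>
    refine ⟨by fun_prop, ?_⟩
    conv_lhs => rw [← hγ.map_eq]
    rw [Measure.map_map (by fun_prop) (by fun_prop)]
    convert! Measure.map_id
    funext y t
    simp

variable [IsProbabilityMeasure μ]

theorem smulInvariantMeasure_glueLaw (hμ : SMulInvariantMeasure cubeIsomᵈᵐᵃ (Cube → K) μ)
    (p : ℝ) : SMulInvariantMeasure cubeIsomᵈᵐᵃ (Cube → K) (glueLaw μ p) := by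
  rw [smulInvariantMeasure_iff_forall_measurePreserving] at hμ
  refine smulInvariantMeasure_cubeIsom (fun σ hσ => ?_) fun i => ?_
  · exact measurePreserving_glueLaw (hμ _ (coordPerm_mem_cubeIsom hσ)) σ 0 fun t =>
      (add_zero _).symm
  · exact measurePreserving_glueLaw (hμ _ (bitFlip_mem_cubeIsom i)) 1
      (Finsupp.single i 1) fun t => by
      rw [bitFlip_apply, coordPerm_one]

theorem uniformUnit_Iio_pos {p : ℝ} (hp : 0 < p) : uniformUnit (Set.Iio p) ≠ 0 := by
  rw [uniformUnit, Measure.restrict_apply measurableSet_Iio, ← pos_iff_ne_zero]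
  refine lt_of_lt_of_le ?_ (measure_mono (s := Set.Ioo 0 (min p 1)) fun x hx =>
    ⟨hx.2.trans_le (min_le_left _ _), hx.1, (hx.2.trans_le (min_le_right _ _)).le⟩)
  simp [hp]

/-- A cylinder set and a suitable translate of its complement are independent on an event whose
probability does not depend on the cylinder set. -/
theorem exists_mul_glueLaw_le (hμ : SMulInvariantMeasure cubeIsomᵈᵐᵃ (Cube → K) μ) (p : ℝ)
    {B : Set (Cube → K)} (hB : B ∈ measurableCylinders fun _ : Cube => K) :
    ∃ γ ∈ cubeIsom, uniformUnit (Set.Iio p) * (glueLaw μ p B * glueLaw μ p Bᶜ) ≤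
      glueLaw μ p (B \ (fun y t => y (γ t)) ⁻¹' B) := by
  obtain ⟨s, S, hS, rfl⟩ := (mem_measurableCylinders B).1 hB
  obtain ⟨n, hn⟩ := Finset.exists_nat_subset_range (s.biUnion Finsupp.support)
  have hs : ∀ t ∈ s, ∀ j, n ≤ j → t j = 0 := fun t ht j hj => by
    by_contra h
    exact (Finset.mem_range.1 (hn (Finset.mem_biUnion.2
      ⟨t, ht, Finsupp.mem_support_iff.2 h⟩))).not_ge hj
  have hmem : bitFlip (2 * n) * coordPerm (blockSwap n) ∈ cubeIsom :=
    mul_mem (bitFlip_mem_cubeIsom _) (coordPerm_mem_cubeIsom (finite_blockSwap_ne n))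
  refine ⟨_, hmem, ?_⟩
  have hγ := smulInvariantMeasure_iff_forall_measurePreserving.1 hμ _ hmem
  rw [compl_cylinder, ← sampleMeasure_glue_inter_glue hγ (fun t => rfl) (fun j => le_blockSwap)
    (by omega) (blockSwap_of_le le_rfl) hs hS hS.compl p,
    ← (measurePreserving_glue μ p).measure_preimage (hS.cylinder.diff
      ((hγ.measurable) hS.cylinder)).nullMeasurableSet]
  exact measure_mono fun z hz => ⟨hz.2.1, hz.2.2⟩

theorem ergodicSMul_glueLaw (hμ : SMulInvariantMeasure cubeIsomᵈᵐᵃ (Cube → K) μ) {p : ℝ}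
    (hp : 0 < p) : ErgodicSMul cubeIsomᵈᵐᵃ (Cube → K) (glueLaw μ p) := by
  have hinv := smulInvariantMeasure_glueLaw hμ p
  refine ⟨fun {A} hA hinvA => ?_⟩
  set ν := glueLaw μ p with hν
  set c := uniformUnit (Set.Iio p) with hc
  -- `A` is almost independent of its complement, by approximation with cylinder sets.
  have hle (ε : ENNReal) (hε : 0 < ε) : c * (ν A * ν Aᶜ) ≤ 4 * ε := by
    obtain ⟨B, hB, hBA⟩ := exists_measure_symmDiff_lt_of_generateFrom_isSetRing (μ := ν)
      (isSetRing_measurableCylinders (α := fun _ : Cube => K))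
      ⟨{Set.univ}, Set.countable_singleton _, by
        simpa using univ_mem_measurableCylinders fun _ : Cube => K, by simp⟩
      generateFrom_measurableCylinders.symm hA hε
    obtain ⟨γ, hγ, hγB⟩ := exists_mul_glueLaw_le hμ p hB
    have hBm : MeasurableSet B :=
      MeasurableSet.of_mem_measurableCylinders (α := fun _ : Cube => K) hB
    have hpres := smulInvariantMeasure_iff_forall_measurePreserving.1 hinv γ hγ
    have hAγ : (fun y t => y (γ t)) ⁻¹' A =ᵐ[ν] A := hinvA (DomMulAct.mk ⟨γ, hγ⟩)
    have hBA' : ν (B \ A) ≤ ε := (measure_mono Set.subset_union_left).trans hBA.le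
    have hAB' : ν (A \ B) ≤ ε := (measure_mono Set.subset_union_right).trans hBA.le
    -- Move the second copy of `B` to the invariant set `A`.
    have h1 : ν (B \ (fun y t => y (γ t)) ⁻¹' B) ≤ ε + ε := calc
      _ ≤ ν (B \ A) + ν (A \ (fun y t => y (γ t)) ⁻¹' B) :=
        (measure_mono (sdiff_triangle _ _ _)).trans (measure_union_le _ _)
      _ = ν (B \ A) + ν (A \ B) := by
        rw [← hpres.measure_preimage (hA.diff hBm).nullMeasurableSet, Set.preimage_sdiff]
        congr 1
        exact measure_congr (hAγ.symm.diff Filter.EventuallyEq.rfl)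
      _ ≤ ε + ε := add_le_add hBA' hAB'
    have hA1 : ν A ≤ ν B + ε :=
      (measure_mono (Set.subset_union_right.trans_eq Set.union_sdiff_self.symm)).trans
        ((measure_union_le _ _).trans (add_le_add le_rfl hAB'))
    have hA2 : ν Aᶜ ≤ ν Bᶜ + ε := by
      refine (measure_mono fun x hx => ?_).trans
        ((measure_union_le Bᶜ (B \ A)).trans (add_le_add le_rfl hBA'))
      by_cases hxB : x ∈ B
      · exact .inr ⟨hxB, hx⟩
      · exact .inl hxB
    calc c * (ν A * ν Aᶜ) ≤ c * ((ν B + ε) * ν Aᶜ) := by gcongr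
      _ = c * (ν B * ν Aᶜ) + c * (ε * ν Aᶜ) := by ring
      _ ≤ c * (ν B * (ν Bᶜ + ε)) + 1 * (ε * 1) := by
        gcongr
        · exact prob_le_one
        · exact prob_le_one
      _ = c * (ν B * ν Bᶜ) + c * (ν B * ε) + 1 * (ε * 1) := by ring
      _ ≤ (ε + ε) + 1 * (1 * ε) + 1 * (ε * 1) := by
        gcongr
        · exact hγB.trans h1
        · exact prob_le_one
        · exact prob_le_one
      _ = 4 * ε := by ring
  have h0 : c * (ν A * ν Aᶜ) = 0 := by
    have hlim : Filter.Tendsto (fun ε : ENNReal => 4 * ε) (𝓝[>] 0) (𝓝 (4 * 0)) :=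
      (ENNReal.Tendsto.const_mul Filter.tendsto_id (.inr (by simp))).mono_left nhdsWithin_le_nhds
    rw [mul_zero] at hlim
    exact nonpos_iff_eq_zero.1 (ge_of_tendsto hlim (eventually_mem_nhdsWithin.mono hle))
  have h0' : ν A = 0 ∨ ν Aᶜ = 0 := by
    simpa [hc, uniformUnit_Iio_pos hp] using h0
  rw [Filter.eventuallyConst_set]
  exact h0'.symm.imp (fun h => h) fun h => measure_eq_zero_iff_ae_notMem.1 h

end Exchangeable

/-! ### Density of the ergodic laws -/

section Density

variable {K : Type*} [TopologicalSpace K] [MeasurableSpace K] [OpensMeasurableSpace (Cube → K)]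

/-- The glued laws are ergodic and converge to the given law as the density of the random set of
coordinates tends to zero. -/
theorem exchangeableLaws_subset_closure_ergodicLaws :
    exchangeableLaws cubeIsom K ⊆ closure (ergodicLaws cubeIsom K) := by
  intro μ hμ
  let ν (p : ℝ) : ProbabilityMeasure (Cube → K) :=
    ⟨glueLaw (μ : Measure (Cube → K)) p, inferInstance⟩
  have hlim : Filter.Tendsto ν (𝓝[>] 0) (𝓝 μ) :=
    ProbabilityMeasure.tendsto_iff_forall_integral_tendsto.2 fun f =>
      (tendsto_integral_glueLaw f).mono_left nhdsWithin_le_nhds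
  refine mem_closure_of_tendsto hlim (eventually_mem_nhdsWithin.mono fun p hp => ?_)
  exact ergodicSMul_glueLaw hμ hp

end Density

/-- The constant configurations give invariant laws. -/
theorem dirac_const_mem_exchangeableLaws {T K : Type*} [MeasurableSpace K]
    (Γ : Subgroup (Equiv.Perm T)) (k : K) :
    (⟨Measure.dirac fun _ => k, inferInstance⟩ : ProbabilityMeasure (T → K)) ∈
      exchangeableLaws Γ K := by
  refine smulInvariantMeasure_iff_forall_measurePreserving.2 fun γ _ => ⟨by fun_prop, ?_⟩
  exact Measure.map_dirac' (by fun_prop) _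

theorem theorem4p2 (K : Type*) [MetricSpace K] [CompactSpace K] [Nontrivial K]
    [MeasurableSpace K] [BorelSpace K] :
    (lawToDual '' exchangeableLaws cubeIsom K).extremePoints ℝ
        = lawToDual '' ergodicLaws cubeIsom K ∧
      closure (ergodicLaws cubeIsom K) = exchangeableLaws cubeIsom K ∧
      IsPoulsenSimplex (lawToDual '' exchangeableLaws cubeIsom K) := by
  have hext : (lawToDual '' exchangeableLaws cubeIsom K).extremePoints ℝ
      = lawToDual '' ergodicLaws cubeIsom K :=
    extremePoints_image_lawToDual_invariantLaws (G := cubeIsomᵈᵐᵃ) (X := Cube → K)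
  have hcl : closure (ergodicLaws cubeIsom K) = exchangeableLaws cubeIsom K :=
    (closure_minimal (fun μ (hμ : ErgodicSMul _ _ _) => hμ.toSMulInvariantMeasure)
      (isClosed_invariantLaws (G := cubeIsomᵈᵐᵃ))).antisymm
      exchangeableLaws_subset_closure_ergodicLaws
  obtain ⟨k, k', hk⟩ := exists_pair_ne K
  have hdirac := dirac_const_mem_exchangeableLaws (K := K) cubeIsom
  refine ⟨hext, hcl, ?_⟩
  exact
    { isChoquetSimplex_image_lawToDual_invariantLaws (G := cubeIsomᵈᵐᵃ) ⟨_, hdirac k⟩ with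
      metrizable := metrizableSpace_image_lawToDual _
      nontrivial := by
        refine ⟨_, ⟨_, hdirac k, rfl⟩, _, ⟨_, hdirac k', rfl⟩, lawToDual_injective.ne fun h => ?_⟩
        have h' := dirac_eq_dirac_iff.1 (congrArg ProbabilityMeasure.toMeasure h)
        exact hk (congrFun h' 0)
      dense_extremePoints := by
        rw [hext, ← hcl]
        exact image_closure_subset_closure_image continuous_lawToDual }
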